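/- Let $n\ge 2$. A permutation $a\in S_n$ is hidden, and its sign $\operatorname{sgn}(a)\in\{1,-1\}$ (equivalently, its coset of $A_n$) is to be determined from queries to the standard action of $S_n$ on $\{1,\dots,n\}$. Quantum model. Let $V=\mathbb C^n$ with orthonormal basis $|1\rangle,\dots,|n\rangle$, and let $\pi(a)|j\rangle=|a(j)\rangle$. A $t$-query adaptive quantum algorithm consists of $N\in\mathbb N$, a unit vector $\psi\in V\otimes\mathbb C^N$, unitary operators $U_1,\dots,U_t$ on $V\otimes\mathbb C^N$, and a POVM $\{E_{1},E_{-1}\}$ on $V\otimes\mathbb C^N$; its output state is $\psi_a=U_t(\pi(a)\otimes I)U_{t-1}(\pi(a)\otimes I)\cdots U_1(\pi(a)\otimes I)\psi$. A $t$-query nonadaptive quantum algorithm consists of $N\in\mathbb N$, a unit vector $\psi\in V^{\otimes t}\otimes\mathbb C^N$ and a POVM $\{E_1,E_{-1}\}$ on this space; its output state is $\psi_a=(\pi(a)^{\otimes t}\otimes I)\psi$. In both cases $x\in\{1,-1\}$ is output with probability $P(x\mid a)=\langle\psi_a|E_x|\psi_a\rangle$. Classical model. A $t$-query deterministic algorithm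 is a decision tree of depth $t$ which at each step queries some $j\in\{1,\dots,n\}$ (depending on the previous answers), receives $a(j)$, and after $t$ queries outputs an element of $\{1,-1\}$. A $t$-query randomized algorithm is a finitely supported probability distribution on such trees, with $P(x\mid a)$ the probability that it outputs $x$. The success probability of an algorithm is $\frac1{n!}\sum_{a\in S_n}P(\operatorname{sgn}(a)\mid a)$, and the algorithm is exact if $P(\operatorname{sgn}(a)\mid a)=1$ for all $a\in S_n$. Then: 1. There are an exact adaptive and an exact nonadaptive quantum algorithm with $\lfloor n/2\rfloor$ queries. 2. For every $t<\lfloor n/2\rfloor$, the maximal success probability of a $t$-query adaptive quantum algorithm is $1/2$ (that of random guessing), and so is that of a $t$-query nonadaptive quantum algorithm. 3. There is an exact deterministic classical algorithm with $n-1$ queries, while for every $t<n-1$ the maximal success probability of a $t$-query randomized classical algorithm is $1/2$. -/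

import Mathlib

open Matrix
open scoped Kronecker ComplexOrder

namespace OracleLearning

/-! Throughout, `Y` is the finite set of hidden information, `X` is the finite set of possible
answers, `f : Y → X` is the function to be learned, and `Ω` is a finite set. Vectors of the Hilbert
space with orthonormal basis indexed by `ι` are functions `ι → ℂ`, and operators are matrices. -/

/-! ### Classical query algorithms -/

/-- A deterministic adaptive classical algorithm making `t` queries: a decision tree. Each query
is an element of `Ω`, and how to continue depends on the answer (again an element of `Ω`). -/
inductive DecisionTree (Ω X : Type*) : ℕ → Type _
  | output (x : X) : DecisionTree Ω X 0
  | query {t : ℕ} (ω : Ω) (next : Ω → DecisionTree Ω X t) : DecisionTree Ω X (t + 1)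

/-- The output of a decision tree when the hidden permutation is `σ`: the query `ω` is answered
by `σ ω`. -/
def DecisionTree.run {Ω X : Type*} (σ : Equiv.Perm Ω) : {t : ℕ} → DecisionTree Ω X t → X
  | _, .output x => x
  | _, .query ω next => (next (σ ω)).run σ

/-- A randomized adaptive classical algorithm making `t` queries: a probability distribution on
finitely many decision trees. -/
structure ClassicalAlgorithm (Ω X : Type*) (t : ℕ) where
  /-- number of values of the random seed -/
  seeds : ℕ
  /-- probability of each seed -/
  weight : Fin seeds → ℝ
  weight_nonneg : ∀ r, 0 ≤ weight r
  weight_sum : ∑ r, weight r = 1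
  /-- the deterministic algorithm run for each seed -/
  tree : Fin seeds → DecisionTree Ω X t

/-- The probability that the algorithm outputs `x` when the hidden permutation is `σ`. -/
noncomputable def ClassicalAlgorithm.prob {Ω X : Type*} [DecidableEq X] {t : ℕ}
    (A : ClassicalAlgorithm Ω X t) (σ : Equiv.Perm Ω) (x : X) : ℝ :=
  ∑ r, if (A.tree r).run σ = x then A.weight r else 0

/-- The average success probability, for hidden information uniformly distributed in `Y`. -/
noncomputable def ClassicalAlgorithm.successProb {Y Ω X : Type*} [Fintype Y] [DecidableEq X]
    {t : ℕ} (A : ClassicalAlgorithm Ω X t) (π : Y → Equiv.Perm Ω) (f : Y → X) : ℝ :=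
  (1 / (Fintype.card Y : ℝ)) * ∑ a, A.prob (π a) (f a)

/-! ### Quantum query algorithms -/

/-- A POVM on `ℂ^ι` with outcomes in `X`. -/
structure POVM (ι X : Type*) [Fintype ι] [DecidableEq ι] [Fintype X] where
  /-- the effect of each outcome -/
  effect : X → Matrix ι ι ℂ
  posSemidef : ∀ x, (effect x).PosSemidef
  sum_eq_one : ∑ x, effect x = 1

/-- The probability `⟨φ| E_x |φ⟩` of the outcome `x` when the state `φ` is measured. -/
noncomputable def POVM.prob {ι X : Type*} [Fintype ι] [DecidableEq ι] [Fintype X]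
    (E : POVM ι X) (φ : ι → ℂ) (x : X) : ℝ :=
  (star φ ⬝ᵥ (E.effect x *ᵥ φ)).re

section Quantum

variable {Y Ω X : Type*} [Fintype Ω] [DecidableEq Ω] [Fintype X]

/-- A `t`-query adaptive quantum algorithm for oracles acting on `V = ℂ^Ω`. -/
structure AdaptiveAlgorithm (Ω X : Type*) [Fintype Ω] [DecidableEq Ω] [Fintype X] (t : ℕ) where
  /-- dimension of the workspace -/
  N : ℕ
  /-- the initial state, a unit vector of `V ⊗ ℂ^N` -/
  ψ : Ω × Fin N → ℂ
  norm_ψ : star ψ ⬝ᵥ ψ = 1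
  /-- the unitary operators applied after each of the queries -/
  U : Fin t → Matrix.unitaryGroup (Ω × Fin N) ℂ
  /-- the final measurement -/
  E : POVM (Ω × Fin N) X

/-- The output state `U_t (O ⊗ I) U_{t-1} (O ⊗ I) ⋯ U_1 (O ⊗ I) ψ` for the oracle `O`. -/
noncomputable def AdaptiveAlgorithm.finalState {t : ℕ} (A : AdaptiveAlgorithm Ω X t)
    (O : Matrix.unitaryGroup Ω ℂ) : Ω × Fin A.N → ℂ :=
  (List.ofFn A.U).foldl
    (fun φ U => (U : Matrix _ _ ℂ) *ᵥ
      (((O : Matrix Ω Ω ℂ) ⊗ₖ (1 : Matrix (Fin A.N) (Fin A.N) ℂ)) *ᵥ φ)) A.ψ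

/-- The probability that the algorithm outputs `x` for the oracle `O`. -/
noncomputable def AdaptiveAlgorithm.prob {t : ℕ} (A : AdaptiveAlgorithm Ω X t)
    (O : Matrix.unitaryGroup Ω ℂ) (x : X) : ℝ :=
  A.E.prob (A.finalState O) x

/-- The average success probability, for hidden information uniformly distributed in `Y`. -/
noncomputable def AdaptiveAlgorithm.successProb [Fintype Y] {t : ℕ} (A : AdaptiveAlgorithm Ω X t)
    (π : Y → Matrix.unitaryGroup Ω ℂ) (f : Y → X) : ℝ :=
  (1 / (Fintype.card Y : ℝ)) * ∑ a, A.prob (π a) (f a)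

/-- The `t`-th tensor power of an operator on `ℂ^Ω`. The space `(ℂ^Ω)^{⊗ t}` has the orthonormal
basis `ω₁ ⊗ ⋯ ⊗ ω_t`, indexed by `Fin t → Ω`. -/
def tensorPower (t : ℕ) (O : Matrix Ω Ω ℂ) : Matrix (Fin t → Ω) (Fin t → Ω) ℂ :=
  Matrix.of fun u v => ∏ i, O (u i) (v i)

/-- A `t`-query nonadaptive quantum algorithm for oracles acting on `V = ℂ^Ω`. -/
structure NonadaptiveAlgorithm (Ω X : Type*) [Fintype Ω] [DecidableEq Ω] [Fintype X]
    (t : ℕ) where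
  /-- dimension of the auxiliary register -/
  N : ℕ
  /-- the input state, a unit vector of `V^{⊗ t} ⊗ ℂ^N` -/
  ψ : (Fin t → Ω) × Fin N → ℂ
  norm_ψ : star ψ ⬝ᵥ ψ = 1
  /-- the final measurement -/
  E : POVM ((Fin t → Ω) × Fin N) X

/-- The output state `(O^{⊗ t} ⊗ I) ψ` for the oracle `O`. -/
noncomputable def NonadaptiveAlgorithm.finalState {t : ℕ} (A : NonadaptiveAlgorithm Ω X t)
    (O : Matrix.unitaryGroup Ω ℂ) : (Fin t → Ω) × Fin A.N → ℂ :=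
  (tensorPower t (O : Matrix Ω Ω ℂ) ⊗ₖ (1 : Matrix (Fin A.N) (Fin A.N) ℂ)) *ᵥ A.ψ

/-- The probability that the algorithm outputs `x` for the oracle `O`. -/
noncomputable def NonadaptiveAlgorithm.prob {t : ℕ} (A : NonadaptiveAlgorithm Ω X t)
    (O : Matrix.unitaryGroup Ω ℂ) (x : X) : ℝ :=
  A.E.prob (A.finalState O) x

/-- The average success probability, for hidden information uniformly distributed in `Y`. -/
noncomputable def NonadaptiveAlgorithm.successProb [Fintype Y] {t : ℕ}
    (A : NonadaptiveAlgorithm Ω X t) (π : Y → Matrix.unitaryGroup Ω ℂ) (f : Y → X) : ℝ :=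
  (1 / (Fintype.card Y : ℝ)) * ∑ a, A.prob (π a) (f a)

end Quantum

/-! ### The permutation representation -/

/-- The matrix of the operator on `ℂ^Ω` that maps the basis vector `|ω⟩` to `|σ ω⟩`. -/
def permOp {Ω : Type*} [DecidableEq Ω] (σ : Equiv.Perm Ω) : Matrix Ω Ω ℂ :=
  Matrix.of fun i j => if i = σ j then 1 else 0

theorem permOp_mulVec_single {Ω : Type*} [Fintype Ω] [DecidableEq Ω] (σ : Equiv.Perm Ω) (ω : Ω) :
    permOp σ *ᵥ Pi.single ω 1 = Pi.single (σ ω) 1 := by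
  ext i
  simp [permOp, Pi.single_apply]

theorem permOp_one {Ω : Type*} [DecidableEq Ω] : permOp (1 : Equiv.Perm Ω) = 1 := by
  ext i j
  by_cases h : i = j <;> simp [permOp, Matrix.one_apply, h]

theorem permOp_mul {Ω : Type*} [Fintype Ω] [DecidableEq Ω] (σ τ : Equiv.Perm Ω) :
    permOp (σ * τ) = permOp σ * permOp τ := by
  ext i j
  by_cases h : i = σ (τ j) <;> simp [permOp, Matrix.mul_apply, h]

theorem permOp_star {Ω : Type*} [DecidableEq Ω] (σ : Equiv.Perm Ω) :
    star (permOp σ) = permOp σ⁻¹ := by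
  ext i j
  simp only [permOp, Matrix.star_apply, Matrix.of_apply, Equiv.Perm.eq_inv_iff_eq]
  by_cases h : j = σ i
  · simp [h]
  · simp [h, Ne.symm h]

/-- The permutation representation of `Sym(Ω)` on `ℂ^Ω`. -/
def permRep (Ω : Type*) [Fintype Ω] [DecidableEq Ω] :
    Equiv.Perm Ω →* Matrix.unitaryGroup Ω ℂ where
  toFun σ := ⟨permOp σ, by
    rw [Matrix.mem_unitaryGroup_iff, permOp_star, ← permOp_mul, mul_inv_cancel, permOp_one]⟩
  map_one' := Subtype.ext permOp_one
  map_mul' σ τ := Subtype.ext (permOp_mul σ τ)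

end OracleLearning

open OracleLearning

/-!
A query algorithm learns about the permutation `a` only through the entries of its permutation
matrix, and the sign is a polynomial in these entries of degree exactly `n - 1`.

*Lower bounds.* The amplitudes of a `t`-query quantum algorithm are polynomials of degree at most
`t` in the entries, so its outcome probabilities have degree at most `2t`
(`AdaptiveAlgorithm.finalState_mem_lowDegree`, `POVM.exists_prob_eq_re_lowDegree`); the output
indicator of a classical decision tree of depth `t` has degree at most `t`
(`DecisionTree.indicator_run_mem_lowDegree`). A monomial of degree at most `n - 2` looks at `a` at
no more than `n - 2` points, so right multiplication by the transposition of two other points fixes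
it and flips the sign. Hence functions of degree at most `n - 2` are orthogonal to the sign
(`sum_sign_mul_eq_zero`), and every algorithm below the threshold succeeds with probability exactly
`1/2` (`average_prob_sign_eq_half`).

*Quantum upper bound.* For `t = ⌊n/2⌋` there is a nonzero operator `J` on the `t`-th tensor power
of `ℂⁿ` with `J ρ(a) = sgn(a) ρ(a) J`, where `ρ(a)` is the action of `a` by the `t`-th tensor power:
the antisymmetrized sum `signTwist`, which for even `n` is the Hodge star on the middle exterior
power. After making `J` Hermitian, take a unit eigenvector `ψ` with a nonzero eigenvalue `c`. Then
`ρ(a) ψ` is an eigenvector with eigenvalue `sgn(a) c`, so measuring `J` reveals the sign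
(`exists_state_measuring_sign`). An adaptive algorithm simulates this nonadaptive one by rotating
the `t` registers through the queried position (`exists_adaptiveAlgorithm_prob_eq`).

*Classical upper bound.* The values at `n - 1` points determine the permutation
(`perm_eq_of_comp_eq`).
-/

namespace OracleLearning

/-! ### Functions of low degree on a symmetric group -/

section LowDegree

variable {Ω : Type*}

/-- The complex functions on `Perm Ω` of degree at most `d`: the linear combinations of functions
`f` whose value `f a` depends only on the restriction of `a` to some set of at most `d` points.
Equivalently, these are the polynomials of degree at most `d` in the entries of the permutation
matrix of `a`. -/
def lowDegree (Ω : Type*) (d : ℕ) : Submodule ℂ (Equiv.Perm Ω → ℂ) :=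
  Submodule.span ℂ {f | ∃ S : Finset Ω, S.card ≤ d ∧
    ∀ a b : Equiv.Perm Ω, (∀ s ∈ S, a s = b s) → f a = f b}

theorem const_mem_lowDegree (c : ℂ) (d : ℕ) : (fun _ : Equiv.Perm Ω => c) ∈ lowDegree Ω d :=
  Submodule.subset_span ⟨∅, by simp, fun _ _ _ => rfl⟩

theorem mul_mem_lowDegree {d e : ℕ} {f g : Equiv.Perm Ω → ℂ} (hf : f ∈ lowDegree Ω d)
    (hg : g ∈ lowDegree Ω e) : f * g ∈ lowDegree Ω (d + e) := by
  classical
  have h := Submodule.mul_mem_mul hf hg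
  rw [lowDegree, lowDegree, Submodule.span_mul_span] at h
  refine Submodule.span_mono ?_ h
  rintro _ ⟨f, ⟨S, hS, hf⟩, g, ⟨T, hT, hg⟩, rfl⟩
  refine ⟨S ∪ T, (Finset.card_union_le S T).trans (by lia), fun a b hab => ?_⟩
  simp only [Pi.mul_apply]
  rw [hf a b fun s hs => hab s (Finset.mem_union_left _ hs),
    hg a b fun s hs => hab s (Finset.mem_union_right _ hs)]

theorem star_mem_lowDegree {d : ℕ} {f : Equiv.Perm Ω → ℂ} (hf : f ∈ lowDegree Ω d) :
    star f ∈ lowDegree Ω d := by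
  induction hf using Submodule.span_induction with
  | mem f hf =>
    obtain ⟨S, hS, hf⟩ := hf
    exact Submodule.subset_span ⟨S, hS, fun a b hab => congrArg star (hf a b hab)⟩
  | zero => simp
  | add f g _ _ hf hg => rw [star_add]; exact add_mem hf hg
  | smul c f _ hf => rw [star_smul]; exact Submodule.smul_mem _ _ hf

theorem entry_mem_lowDegree [DecidableEq Ω] (i j : Ω) :
    (fun a : Equiv.Perm Ω => permOp a i j) ∈ lowDegree Ω 1 :=
  Submodule.subset_span ⟨{j}, by simp, fun a b hab => by
    simp [permOp, hab j (Finset.mem_singleton_self j)]⟩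

/-- A function of degree at most `|Ω| - 2` is orthogonal to the sign: right multiplication by the
transposition of two points that a term of the function ignores preserves that term and flips the
sign. -/
theorem sum_sign_mul_eq_zero [Fintype Ω] [DecidableEq Ω] {d : ℕ} (hd : d + 2 ≤ Fintype.card Ω)
    {f : Equiv.Perm Ω → ℂ} (hf : f ∈ lowDegree Ω d) :
    ∑ a : Equiv.Perm Ω, ((Equiv.Perm.sign a : ℤ) : ℂ) * f a = 0 := by
  induction hf using Submodule.span_induction with
  | mem f hf =>
    obtain ⟨S, hS, hf⟩ := hf
    have hS' : 1 < Sᶜ.card := by rw [Finset.card_compl]; lia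
    obtain ⟨i, hi, j, hj, hij⟩ := Finset.one_lt_card.1 hS'
    rw [Finset.mem_compl] at hi hj
    have h : ∑ a : Equiv.Perm Ω, ((Equiv.Perm.sign a : ℤ) : ℂ) * f a
        = -∑ a : Equiv.Perm Ω, ((Equiv.Perm.sign a : ℤ) : ℂ) * f a := by
      conv_lhs => rw [← Equiv.sum_comp (Equiv.mulRight (Equiv.swap i j))]
      rw [← Finset.sum_neg_distrib]
      refine Finset.sum_congr rfl fun a _ => ?_
      have hfa : f (a * Equiv.swap i j) = f a := hf _ _ fun s hs => by
        rw [Equiv.Perm.mul_apply, Equiv.swap_apply_of_ne_of_ne]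
        · rintro rfl; exact hi hs
        · rintro rfl; exact hj hs
      simp [Equiv.Perm.sign_mul, Equiv.Perm.sign_swap hij, hfa]
    exact self_eq_neg.1 h
  | zero => simp
  | add f g _ _ hf hg => simp [mul_add, Finset.sum_add_distrib, hf, hg]
  | smul c f _ hf =>
    simp only [Pi.smul_apply, smul_eq_mul, mul_left_comm _ c]
    rw [← Finset.mul_sum, hf, mul_zero]

/-- Averaged over all permutations, a `{1, -1}`-valued guess whose outcome probabilities have
degree at most `|Ω| - 2` equals the sign with probability exactly `1/2`. -/
theorem average_prob_sign_eq_half [Fintype Ω] [DecidableEq Ω] {d : ℕ}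
    (hd : d + 2 ≤ Fintype.card Ω) {p : Equiv.Perm Ω → ℤˣ → ℝ}
    (hp : ∀ a, p a 1 + p a (-1) = 1)
    (hf : ∀ x, ∃ f ∈ lowDegree Ω d, ∀ a, p a x = (f a).re) :
    (1 / (Fintype.card (Equiv.Perm Ω) : ℝ)) * ∑ a, p a (Equiv.Perm.sign a) = 1 / 2 := by
  obtain ⟨f, hf, hpf⟩ := hf 1
  have h0 : ∑ a : Equiv.Perm Ω, ((Equiv.Perm.sign a : ℤ) : ℝ) * p a 1 = 0 := by
    have h := congrArg Complex.re (sum_sign_mul_eq_zero hd hf)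
    rw [Complex.re_sum] at h
    rw [← Complex.zero_re, ← h]
    refine Finset.sum_congr rfl fun a _ => ?_
    rw [hpf a, ← Complex.ofReal_intCast, Complex.re_ofReal_mul]
  have h1 : ∑ a : Equiv.Perm Ω, ((Equiv.Perm.sign a : ℤ) : ℝ) = 0 := by
    have h := congrArg Complex.re (sum_sign_mul_eq_zero hd (const_mem_lowDegree (Ω := Ω) 1 d))
    rw [Complex.re_sum] at h
    rw [← Complex.zero_re, ← h]
    refine Finset.sum_congr rfl fun a _ => ?_
    simp
  have h2 : ∀ a : Equiv.Perm Ω, p a (Equiv.Perm.sign a) =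
      1 / 2 + (((Equiv.Perm.sign a : ℤ) : ℝ) * p a 1 - ((Equiv.Perm.sign a : ℤ) : ℝ) * (1 / 2)) := by
    intro a
    have := hp a
    rcases Int.units_eq_one_or (Equiv.Perm.sign a) with h | h <;> rw [h] <;> push_cast <;> linarith
  simp_rw [h2]
  rw [Finset.sum_add_distrib, Finset.sum_sub_distrib, h0, ← Finset.sum_mul, h1]
  have : (Fintype.card (Equiv.Perm Ω) : ℝ) ≠ 0 := by simp [Fintype.card_ne_zero]
  simp only [Finset.sum_const, Finset.card_univ, nsmul_eq_mul]
  field_simp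
  simp

end LowDegree

/-! ### Lower bounds -/

section LowerBounds

/-- Summing over the answer `ω` to the first query expresses the indicator of an output as a sum of
products of one matrix entry with the indicator of a subtree. -/
theorem DecisionTree.indicator_run_mem_lowDegree {Ω X : Type*} [Fintype Ω] [DecidableEq Ω]
    [DecidableEq X] (x : X) {t : ℕ} (T : DecisionTree Ω X t) :
    (fun a : Equiv.Perm Ω => if T.run a = x then (1 : ℂ) else 0) ∈ lowDegree Ω t := by
  induction T with
  | output y => exact const_mem_lowDegree (if y = x then 1 else 0) _
  | @query t q next ih =>
    have h : (fun a : Equiv.Perm Ω => if (DecisionTree.query q next).run a = x then (1 : ℂ) else 0)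
        = ∑ ω, (fun a : Equiv.Perm Ω => permOp a ω q) *
            (fun a => if (next ω).run a = x then (1 : ℂ) else 0) := by
      ext a
      simp only [permOp, DecisionTree.run, Finset.sum_apply, Pi.mul_apply, of_apply, ite_mul,
        one_mul, zero_mul, Finset.sum_ite_eq', Finset.mem_univ, if_true]
      rfl
    rw [h, add_comm]
    exact sum_mem fun ω _ => mul_mem_lowDegree (entry_mem_lowDegree ω q) (ih ω)

theorem sum_univ_int_units {M : Type*} [AddCommMonoid M] (f : ℤˣ → M) :
    ∑ x, f x = f 1 + f (-1) := by
  rw [show (Finset.univ : Finset ℤˣ) = {1, -1} by decide, Finset.sum_pair (by decide)]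

theorem ClassicalAlgorithm.successProb_sign_eq_half {Ω : Type*} [Fintype Ω] [DecidableEq Ω]
    {t : ℕ} (ht : t + 2 ≤ Fintype.card Ω) (A : ClassicalAlgorithm Ω ℤˣ t) :
    A.successProb (fun a : Equiv.Perm Ω => a) Equiv.Perm.sign = 1 / 2 := by
  refine average_prob_sign_eq_half ht (p := fun a x => A.prob a x) (fun a => ?_) fun x => ?_
  · rw [← sum_univ_int_units, ← A.weight_sum]
    simp only [ClassicalAlgorithm.prob]
    rw [Finset.sum_comm]
    simp only [Finset.sum_ite_eq, Finset.mem_univ, if_true]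
  · refine ⟨∑ r, (A.weight r : ℂ) • fun a : Equiv.Perm Ω => if (A.tree r).run a = x then 1 else 0,
      sum_mem fun r _ => Submodule.smul_mem _ _ ((A.tree r).indicator_run_mem_lowDegree x),
      fun a => ?_⟩
    simp only [ClassicalAlgorithm.prob, Finset.sum_apply, Complex.re_sum, Pi.smul_apply]
    refine Finset.sum_congr rfl fun r _ => ?_
    split_ifs <;> simp

variable {ι : Type*} [Fintype ι] [DecidableEq ι]

theorem POVM.prob_add_prob (E : POVM ι ℤˣ) {φ : ι → ℂ} (hφ : star φ ⬝ᵥ φ = 1) :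
    E.prob φ 1 + E.prob φ (-1) = 1 := by
  rw [POVM.prob, POVM.prob, ← Complex.add_re, ← dotProduct_add, ← add_mulVec,
    ← sum_univ_int_units E.effect, E.sum_eq_one, one_mulVec, hφ, Complex.one_re]

/-- If the amplitudes of a state have degree at most `t`, the outcome probabilities of a
measurement have degree at most `2t`. -/
theorem POVM.exists_prob_eq_re_lowDegree {Ω X : Type*} [Fintype X] (E : POVM ι X) {t : ℕ}
    {φ : Equiv.Perm Ω → ι → ℂ} (hφ : ∀ i, (fun a => φ a i) ∈ lowDegree Ω t) (x : X) :
    ∃ f ∈ lowDegree Ω (t + t), ∀ a, E.prob (φ a) x = (f a).re := by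
  refine ⟨∑ i, star (fun a => φ a i) * ∑ j, E.effect x i j • fun a => φ a j,
    sum_mem fun i _ => mul_mem_lowDegree (star_mem_lowDegree (hφ i))
      (sum_mem fun j _ => Submodule.smul_mem _ _ (hφ j)), fun a => ?_⟩
  simp [POVM.prob, dotProduct, mulVec, Finset.sum_apply]

theorem kronecker_one_mulVec_apply {α κ : Type*} [Fintype α] [Fintype κ] [DecidableEq κ]
    (M : Matrix α α ℂ) (φ : α × κ → ℂ) (i : α) (m : κ) :
    ((M ⊗ₖ (1 : Matrix κ κ ℂ)) *ᵥ φ) (i, m) = ∑ j, M i j * φ (j, m) := by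
  simp [mulVec, dotProduct, Fintype.sum_prod_type, kroneckerMap_apply, one_apply]

theorem star_dotProduct_mulVec_self_of_unitary {M : Matrix ι ι ℂ} (hM : M ∈ unitaryGroup ι ℂ)
    (φ : ι → ℂ) : star (M *ᵥ φ) ⬝ᵥ (M *ᵥ φ) = star φ ⬝ᵥ φ := by
  rw [star_mulVec, ← dotProduct_mulVec, mulVec_mulVec, ← star_eq_conjTranspose,
    mem_unitaryGroup_iff'.1 hM, one_mulVec]

variable {Ω : Type*} [Fintype Ω] [DecidableEq Ω]

theorem AdaptiveAlgorithm.star_finalState_dotProduct_finalState {X : Type*} [Fintype X] {t : ℕ}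
    (A : AdaptiveAlgorithm Ω X t) (O : unitaryGroup Ω ℂ) :
    star (A.finalState O) ⬝ᵥ A.finalState O = 1 := by
  have h : ∀ (l : List (unitaryGroup (Ω × Fin A.N) ℂ)) (φ : Ω × Fin A.N → ℂ),
      star φ ⬝ᵥ φ = 1 →
      star (l.foldl (fun φ U => (U : Matrix _ _ ℂ) *ᵥ
        (((O : Matrix Ω Ω ℂ) ⊗ₖ (1 : Matrix (Fin A.N) (Fin A.N) ℂ)) *ᵥ φ)) φ) ⬝ᵥ
      l.foldl (fun φ U => (U : Matrix _ _ ℂ) *ᵥ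
        (((O : Matrix Ω Ω ℂ) ⊗ₖ (1 : Matrix (Fin A.N) (Fin A.N) ℂ)) *ᵥ φ)) φ = 1 := by
    intro l
    induction l with
    | nil => exact fun φ h => h
    | cons U l ih =>
      intro φ hφ
      refine ih _ ?_
      rw [star_dotProduct_mulVec_self_of_unitary U.2, star_dotProduct_mulVec_self_of_unitary
        (kronecker_mem_unitary O.2 (one_mem _)), hφ]
  exact h _ _ A.norm_ψ

/-- Each query raises the degree of the amplitudes by at most one. -/
theorem AdaptiveAlgorithm.finalState_mem_lowDegree {X : Type*} [Fintype X] {t : ℕ}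
    (A : AdaptiveAlgorithm Ω X t) (i : Ω × Fin A.N) :
    (fun a => A.finalState (permRep Ω a) i) ∈ lowDegree Ω t := by
  have h : ∀ (l : List (unitaryGroup (Ω × Fin A.N) ℂ)) (d : ℕ)
      (φ : Equiv.Perm Ω → Ω × Fin A.N → ℂ), (∀ i, (fun a => φ a i) ∈ lowDegree Ω d) →
      ∀ i, (fun a => l.foldl (fun φ U => (U : Matrix _ _ ℂ) *ᵥ
        (((permRep Ω a : Matrix Ω Ω ℂ)) ⊗ₖ (1 : Matrix (Fin A.N) (Fin A.N) ℂ)) *ᵥ φ) (φ a) i)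
          ∈ lowDegree Ω (d + l.length) := by
    intro l
    induction l with
    | nil => exact fun d φ h => h
    | cons U l ih =>
      intro d φ hφ i
      rw [List.length_cons, add_comm l.length 1, ← add_assoc]
      refine ih (d + 1) (fun a => (U : Matrix _ _ ℂ) *ᵥ
        (((permRep Ω a : Matrix Ω Ω ℂ)) ⊗ₖ (1 : Matrix (Fin A.N) (Fin A.N) ℂ)) *ᵥ φ a)
        (fun i => ?_) i
      have h : (fun a => ((U : Matrix _ _ ℂ) *ᵥ (((permRep Ω a : Matrix Ω Ω ℂ)) ⊗ₖ
          (1 : Matrix (Fin A.N) (Fin A.N) ℂ)) *ᵥ φ a) i) =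
          ∑ j : Ω × Fin A.N, (U : Matrix _ _ ℂ) i j •
            ∑ k, (fun a => permOp a j.1 k) * fun a => φ a (k, j.2) := by
        ext a
        rw [mulVec, dotProduct, Finset.sum_apply]
        refine Finset.sum_congr rfl fun j _ => ?_
        rw [← Prod.mk.eta (p := j), kronecker_one_mulVec_apply]
        simp [Finset.sum_apply, permRep]
      rw [h, add_comm d 1]
      exact sum_mem fun j _ => Submodule.smul_mem _ _ <| sum_mem fun k _ =>
        mul_mem_lowDegree (entry_mem_lowDegree _ _) (hφ _)
  have := h (List.ofFn A.U) 0 (fun _ => A.ψ) (fun i => const_mem_lowDegree _ _) i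
  rwa [List.length_ofFn, zero_add] at this

theorem AdaptiveAlgorithm.successProb_sign_eq_half {t : ℕ} (ht : t + t + 2 ≤ Fintype.card Ω)
    (A : AdaptiveAlgorithm Ω ℤˣ t) :
    A.successProb (permRep Ω) Equiv.Perm.sign = 1 / 2 :=
  average_prob_sign_eq_half ht (p := fun a x => A.prob (permRep Ω a) x)
    (fun _ => A.E.prob_add_prob (A.star_finalState_dotProduct_finalState _))
    (A.E.exists_prob_eq_re_lowDegree A.finalState_mem_lowDegree)

/-- A nonadaptive algorithm moves the amplitude of the query word `u` to the word `σ ∘ u`. -/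
theorem NonadaptiveAlgorithm.finalState_permRep {X : Type*} [Fintype X] {t : ℕ}
    (A : NonadaptiveAlgorithm Ω X t) (σ : Equiv.Perm Ω) (u : Fin t → Ω) (m : Fin A.N) :
    A.finalState (permRep Ω σ) (u, m) = A.ψ (σ.symm ∘ u, m) := by
  have h : ∀ v : Fin t → Ω, tensorPower t (permOp σ) u v = if v = σ.symm ∘ u then 1 else 0 := by
    intro v
    simp only [tensorPower, permOp, of_apply, Fintype.prod_ite_zero, Finset.prod_const_one]
    refine if_congr ?_ rfl rfl
    simp [funext_iff, Equiv.eq_symm_apply, eq_comm]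
  rw [NonadaptiveAlgorithm.finalState, kronecker_one_mulVec_apply]
  simp [permRep, h]

theorem NonadaptiveAlgorithm.star_finalState_dotProduct_finalState {X : Type*} [Fintype X] {t : ℕ}
    (A : NonadaptiveAlgorithm Ω X t) (σ : Equiv.Perm Ω) :
    star (A.finalState (permRep Ω σ)) ⬝ᵥ A.finalState (permRep Ω σ) = 1 := by
  rw [← A.norm_ψ]
  simp only [dotProduct, Pi.star_apply]
  rw [Fintype.sum_prod_type, Fintype.sum_prod_type,
    ← Equiv.sum_comp (Equiv.arrowCongr (Equiv.refl (Fin t)) σ)]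
  refine Finset.sum_congr rfl fun u _ => Finset.sum_congr rfl fun m _ => ?_
  rw [A.finalState_permRep]
  have : σ.symm ∘ (Equiv.arrowCongr (Equiv.refl (Fin t)) σ) u = u := by ext; simp
  rw [this]

theorem NonadaptiveAlgorithm.finalState_mem_lowDegree {X : Type*} [Fintype X] {t : ℕ}
    (A : NonadaptiveAlgorithm Ω X t) (i : (Fin t → Ω) × Fin A.N) :
    (fun a => A.finalState (permRep Ω a) i) ∈ lowDegree Ω t := by
  obtain ⟨u, m⟩ := i
  have h : (fun a => A.finalState (permRep Ω a) (u, m)) =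
      ∑ v, A.ψ (v, m) • fun a => tensorPower t (permOp a) u v := by
    ext a
    rw [NonadaptiveAlgorithm.finalState, kronecker_one_mulVec_apply, Finset.sum_apply]
    exact Finset.sum_congr rfl fun v _ => mul_comm _ _
  rw [h]
  refine sum_mem fun v _ => Submodule.smul_mem _ _ (Submodule.subset_span
    ⟨Finset.univ.image v, Finset.card_image_le.trans (by simp), fun a b hab => ?_⟩)
  simp only [tensorPower, permOp, of_apply]
  exact Finset.prod_congr rfl fun i _ => by rw [hab (v i) (by simp)]

theorem NonadaptiveAlgorithm.successProb_sign_eq_half {t : ℕ} (ht : t + t + 2 ≤ Fintype.card Ω)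
    (A : NonadaptiveAlgorithm Ω ℤˣ t) :
    A.successProb (permRep Ω) Equiv.Perm.sign = 1 / 2 :=
  average_prob_sign_eq_half ht (p := fun a x => A.prob (permRep Ω a) x)
    (fun _ => A.E.prob_add_prob (A.star_finalState_dotProduct_finalState _))
    (A.E.exists_prob_eq_re_lowDegree A.finalState_mem_lowDegree)

/-! ### Trivial algorithms and trees with fixed queries -/

/-- The measurement that ignores the state and always reports `1`. -/
noncomputable def POVM.alwaysOne (ι : Type*) [Fintype ι] [DecidableEq ι] : POVM ι ℤˣ where
  effect x := if x = 1 then 1 else 0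
  posSemidef x := by
    split_ifs
    · exact PosSemidef.one
    · exact PosSemidef.zero
  sum_eq_one := by simp

theorem nonempty_adaptiveAlgorithm [Nonempty Ω] (t : ℕ) :
    Nonempty (AdaptiveAlgorithm Ω ℤˣ t) :=
  ⟨{ N := 1
     ψ := Pi.single (Classical.arbitrary Ω, 0) 1
     norm_ψ := by simp
     U := fun _ => 1
     E := POVM.alwaysOne _ }⟩

theorem nonempty_nonadaptiveAlgorithm [Nonempty Ω] (t : ℕ) :
    Nonempty (NonadaptiveAlgorithm Ω ℤˣ t) :=
  ⟨{ N := 1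
     ψ := Pi.single (fun _ => Classical.arbitrary Ω, 0) 1
     norm_ψ := by simp
     E := POVM.alwaysOne _ }⟩

/-- Any function of the answers to a fixed list of queries is computed by a decision tree. -/
theorem exists_decisionTree_run_eq {Ω X : Type*} {t : ℕ} (q : Fin t → Ω)
    (g : (Fin t → Ω) → X) :
    ∃ T : DecisionTree Ω X t, ∀ σ : Equiv.Perm Ω, T.run σ = g (σ ∘ q) := by
  induction t with
  | zero => exact ⟨.output (g Fin.elim0), fun σ => congrArg g (Subsingleton.elim _ _)⟩
  | succ t ih =>
    choose next hnext using fun ω => ih (q ∘ Fin.succ) fun v => g (Fin.cons ω v)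
    refine ⟨.query (q 0) next, fun σ => ?_⟩
    rw [DecisionTree.run, hnext]
    congr 1
    ext i
    refine Fin.cases ?_ (fun i => ?_) i <;> simp

theorem nonempty_classicalAlgorithm {Ω : Type*} [Nonempty Ω] (t : ℕ) :
    Nonempty (ClassicalAlgorithm Ω ℤˣ t) :=
  ⟨{ seeds := 1
     weight := fun _ => 1
     weight_nonneg := fun _ => zero_le_one
     weight_sum := by simp
     tree := fun _ =>
      (exists_decisionTree_run_eq (fun _ => Classical.arbitrary Ω) fun _ => 1).choose }⟩

end LowerBounds

/-! ### Operators that intertwine a tensor power with its twist by the sign -/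

section SignTwisted

/-- A permutation is determined by its values at all points but at most one: the support of a
permutation never has exactly one element. -/
theorem perm_eq_of_comp_eq {Ω κ : Type*} [Fintype Ω] [DecidableEq Ω] [Fintype κ] {q : κ → Ω}
    (hq : Function.Injective q) (hcard : Fintype.card Ω ≤ Fintype.card κ + 1)
    {σ τ : Equiv.Perm Ω} (h : σ ∘ q = τ ∘ q) : σ = τ := by
  classical
  have h1 : (τ⁻¹ * σ).support ⊆ (Finset.univ.map ⟨q, hq⟩)ᶜ := by
    intro x hx
    rw [Finset.mem_compl]
    intro hx'
    obtain ⟨k, -, rfl⟩ := Finset.mem_map.1 hx'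
    rw [Equiv.Perm.mem_support] at hx
    exact hx (by simp [Equiv.Perm.mul_apply,
      show σ (q k) = τ (q k) from congrFun h k])
  have h2 := Finset.card_le_card h1
  rw [Finset.card_compl, Finset.card_map, Finset.card_univ] at h2
  have h3 : τ⁻¹ * σ = 1 := Equiv.Perm.card_support_le_one.1 (by lia)
  exact (inv_mul_eq_one.1 h3).symm

variable {Ω : Type*} [DecidableEq Ω] [Fintype Ω] {κ : Type*}

/-- A matrix `H`, indexed by words, is sign-twisted if `H ρ(σ) = sgn(σ) ρ(σ) H` for every
permutation `σ`, where `ρ(σ)` maps the basis vector `|u⟩` to `|σ ∘ u⟩`; here this relation is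
written in terms of the entries of `H`. -/
def IsSignTwisted (H : Matrix (κ → Ω) (κ → Ω) ℂ) : Prop :=
  ∀ (σ : Equiv.Perm Ω) (u v : κ → Ω),
    H (σ ∘ u) (σ ∘ v) = ((Equiv.Perm.sign σ : ℤ) : ℂ) * H u v

/-- Translating an eigenvector of a sign-twisted matrix by `σ` multiplies its eigenvalue by
`sgn σ`. -/
theorem IsSignTwisted.mulVec_comp [Fintype κ] [DecidableEq κ] {H : Matrix (κ → Ω) (κ → Ω) ℂ}
    (hH : IsSignTwisted H) {ψ : (κ → Ω) → ℂ} {c : ℂ} (hψ : H *ᵥ ψ = c • ψ) (σ : Equiv.Perm Ω) :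
    (H *ᵥ fun u => ψ (σ.symm ∘ u)) =
      (((Equiv.Perm.sign σ : ℤ) : ℂ) * c) • fun u => ψ (σ.symm ∘ u) := by
  ext u
  have h := congrFun hψ (σ.symm ∘ u)
  simp only [mulVec, dotProduct, Pi.smul_apply, smul_eq_mul] at h ⊢
  rw [mul_assoc, ← h, Finset.mul_sum, ← Equiv.sum_comp (Equiv.arrowCongr (Equiv.refl κ) σ)]
  refine Finset.sum_congr rfl fun v _ => ?_
  have h1 : (Equiv.arrowCongr (Equiv.refl κ) σ) v = σ ∘ v := by ext; simp
  have h2 : u = σ ∘ (σ.symm ∘ u) := by ext; simp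
  have h3 : σ.symm ∘ (σ ∘ v) = v := by ext; simp
  rw [h1, h3, ← mul_assoc, ← hH σ, ← h2]

/-- The sum of `sgn(τ) |τ ∘ α⟩⟨τ ∘ β|` over all permutations `τ`. If `α` and `β` enumerate
complementary sets, this is, up to a scalar, the Hodge star on the exterior power. -/
def signTwist (α β : κ → Ω) [DecidableEq (κ → Ω)] : Matrix (κ → Ω) (κ → Ω) ℂ :=
  of fun u v => ∑ τ : Equiv.Perm Ω,
    if τ ∘ α = u ∧ τ ∘ β = v then ((Equiv.Perm.sign τ : ℤ) : ℂ) else 0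

theorem isSignTwisted_signTwist (α β : κ → Ω) [DecidableEq (κ → Ω)] :
    IsSignTwisted (signTwist α β) := by
  intro σ u v
  simp only [signTwist, of_apply]
  rw [← Equiv.sum_comp (Equiv.mulLeft σ), Finset.mul_sum]
  refine Finset.sum_congr rfl fun τ _ => ?_
  have h : ∀ w z : κ → Ω, (⇑(σ * τ) ∘ w = σ ∘ z) ↔ τ ∘ w = z := by
    intro w z
    rw [Equiv.Perm.coe_mul, Function.comp_assoc, σ.injective.comp_left.eq_iff]
  simp only [Equiv.coe_mulLeft, h, Equiv.Perm.sign_mul, Units.val_mul, Int.cast_mul, mul_ite,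
    mul_zero]

/-- If `α` and `β` together enumerate all points but at most one, only the identity contributes to
the entry at `(α, β)`. -/
theorem signTwist_apply_self [Fintype κ] [DecidableEq (κ → Ω)] {α β : κ → Ω}
    (h : Function.Injective (Sum.elim α β))
    (hcard : Fintype.card Ω ≤ Fintype.card κ + Fintype.card κ + 1) : signTwist α β α β = 1 := by
  simp only [signTwist, of_apply]
  rw [Finset.sum_eq_single 1]
  · simp
  · intro τ _ hτ
    rw [if_neg]
    rintro ⟨h1, h2⟩
    refine hτ (perm_eq_of_comp_eq h (by simpa using hcard) ?_)
    rw [Sum.comp_elim, h1, h2]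
    simp
  · simp

/-- From a nonzero sign-twisted matrix `J` one gets a Hermitian one: `J + Jᴴ`, or `i J` if this
vanishes. -/
theorem exists_isHermitian_isSignTwisted {J : Matrix (κ → Ω) (κ → Ω) ℂ} (hJ : IsSignTwisted J)
    (h0 : J ≠ 0) : ∃ H : Matrix (κ → Ω) (κ → Ω) ℂ, H.IsHermitian ∧ IsSignTwisted H ∧ H ≠ 0 := by
  have hJ' : IsSignTwisted Jᴴ := fun σ u v => by
    simp [conjTranspose_apply, hJ σ v u]
  by_cases h : J + Jᴴ = 0
  · refine ⟨Complex.I • J, ?_, fun σ u v => ?_, by simpa using h0⟩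
    · rw [IsHermitian, conjTranspose_smul, eq_neg_of_add_eq_zero_right h]
      simp
    · simp [hJ σ u v, mul_left_comm]
  · exact ⟨J + Jᴴ, isHermitian_add_transpose_self J,
      fun σ u v => by simp [hJ σ u v, hJ' σ u v, mul_add, -conjTranspose_apply], h⟩

end SignTwisted

/-! ### Exact algorithms -/

section Exact

variable {ι : Type*} [Fintype ι] [DecidableEq ι]

/-- Measuring whether the eigenvalue of a Hermitian matrix is `c` distinguishes the eigenvalues
`c` and `-c` perfectly. -/
theorem exists_povm_of_isHermitian {H : Matrix ι ι ℂ} (hH : H.IsHermitian) {c : ℝ} (hc : c ≠ 0) :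
    ∃ E : POVM ι ℤˣ, ∀ (s : ℤˣ) (φ : ι → ℂ), star φ ⬝ᵥ φ = 1 →
      H *ᵥ φ = (((s : ℤ) : ℂ) * c) • φ → E.prob φ s = 1 := by
  classical
  let U : Matrix ι ι ℂ := hH.eigenvectorUnitary
  have hU : U * star U = 1 := mem_unitaryGroup_iff.1 hH.eigenvectorUnitary.2
  have hU' : star U * U = 1 := mem_unitaryGroup_iff'.1 hH.eigenvectorUnitary.2
  -- the eigenvalues of the two effects: projections onto the eigenspace of `c` and its complement
  let d : ℤˣ → ι → ℂ := fun s i =>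
    if s = 1 then (if hH.eigenvalues i = c then 1 else 0)
    else (if hH.eigenvalues i = c then 0 else 1)
  refine ⟨{ effect := fun s => U * diagonal (d s) * Uᴴ
            posSemidef := fun s => (PosSemidef.diagonal fun i => ?_).mul_mul_conjTranspose_same U
            sum_eq_one := ?_ }, fun s φ hφ h => ?_⟩
  · simp only [d]
    split_ifs <;> simp
  · rw [sum_univ_int_units, ← add_mul, ← mul_add, diagonal_add]
    have : (fun i => d 1 i + d (-1) i) = fun _ => 1 := by
      ext i
      by_cases h : hH.eigenvalues i = c <;> simp [d, h]
    rw [this, diagonal_one, mul_one, ← star_eq_conjTranspose, hU]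
  · have hspec : star U * H = diagonal (RCLike.ofReal ∘ hH.eigenvalues) * star U := by
      conv_lhs => rw [hH.spectral_theorem, Unitary.conjStarAlgAut_apply]
      rw [← mul_assoc, ← mul_assoc]
      change star U * U * _ * star U = _
      rw [hU', one_mul]
    -- the coordinates of `φ` outside the range of the effect vanish
    have hcoord : ∀ i, d s i * (star U *ᵥ φ) i = (star U *ᵥ φ) i := by
      intro i
      have h1 : (hH.eigenvalues i : ℂ) * (star U *ᵥ φ) i = ((s : ℤ) : ℂ) * c * (star U *ᵥ φ) i := by
        have h2 := congrFun (congrArg (star U *ᵥ ·) h) i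
        simp only [mulVec_mulVec, hspec, mulVec_smul, Pi.smul_apply, smul_eq_mul] at h2
        rw [← mulVec_mulVec, mulVec_diagonal] at h2
        exact h2
      by_cases h0 : (star U *ᵥ φ) i = 0
      · rw [h0, mul_zero]
      · have h2 := mul_right_cancel₀ h0 h1
        have h3 : hH.eigenvalues i = (s : ℤ) * c := by exact_mod_cast h2
        rcases Int.units_eq_one_or s with rfl | rfl
        · simp [d, h3]
        · have : -c ≠ c := fun h => hc (by linarith)
          simp [d, h3, this]
    have hE : (U * diagonal (d s) * Uᴴ) *ᵥ φ = φ := by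
      have h1 : diagonal (d s) *ᵥ (star U *ᵥ φ) = star U *ᵥ φ := by
        ext i
        rw [mulVec_diagonal, hcoord]
      rw [← mulVec_mulVec, ← star_eq_conjTranspose, ← mulVec_mulVec, h1, mulVec_mulVec, hU,
        one_mulVec]
    rw [POVM.prob, hE, hφ, Complex.one_re]

theorem exists_unit_eigenvector {H : Matrix ι ι ℂ} (hH : H.IsHermitian) (h0 : H ≠ 0) :
    ∃ (c : ℝ) (ψ : ι → ℂ), c ≠ 0 ∧ star ψ ⬝ᵥ ψ = 1 ∧ H *ᵥ ψ = (c : ℂ) • ψ := by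
  obtain ⟨i, hi⟩ := Function.ne_iff.1 (mt hH.eigenvalues_eq_zero_iff.1 h0)
  refine ⟨hH.eigenvalues i, (hH.eigenvectorBasis i).ofLp, hi, ?_, ?_⟩
  · have h := hH.eigenvectorBasis.orthonormal.1 i
    have h2 := inner_self_eq_norm_sq_to_K (𝕜 := ℂ) (hH.eigenvectorBasis i)
    rw [h, EuclideanSpace.inner_eq_star_dotProduct, dotProduct_comm] at h2
    simpa using h2
  · rw [hH.mulVec_eigenvectorBasis i]
    rfl

/-- A state on `t` registers whose translate by any permutation `σ` is recognised, by a fixed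
measurement, as having sign `sgn σ`. For even `n` two words of length `n / 2` enumerate all the
points; for odd `n` they miss one, which `perm_eq_of_comp_eq` allows. -/
theorem exists_state_measuring_sign {n t : ℕ} (h1 : t + t ≤ n) (h2 : n ≤ t + t + 1) :
    ∃ ψ : (Fin t → Fin n) → ℂ, star ψ ⬝ᵥ ψ = 1 ∧ ∃ E : POVM (Fin t → Fin n) ℤˣ,
      ∀ σ : Equiv.Perm (Fin n), E.prob (fun u => ψ (σ.symm ∘ u)) (Equiv.Perm.sign σ) = 1 := by
  let α : Fin t → Fin n := fun i => ⟨i, by lia⟩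
  let β : Fin t → Fin n := fun i => ⟨t + i, by lia⟩
  have hinj : Function.Injective (Sum.elim α β) := by
    rintro (i | i) (j | j) h <;> simp [α, β, Fin.ext_iff] at h ⊢ <;> lia
  have hJ : signTwist α β ≠ 0 := fun h => by
    have := signTwist_apply_self hinj (by simpa using h2)
    simp [h] at this
  obtain ⟨H, hH, hT, h0⟩ := exists_isHermitian_isSignTwisted (isSignTwisted_signTwist α β) hJ
  obtain ⟨c, ψ, hc, hψ, hcψ⟩ := exists_unit_eigenvector hH h0
  obtain ⟨E, hE⟩ := exists_povm_of_isHermitian hH hc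
  refine ⟨ψ, hψ, E, fun σ => hE _ _ ?_ (hT.mulVec_comp hcψ σ)⟩
  rw [← hψ]
  simp only [dotProduct, Pi.star_apply]
  rw [← Equiv.sum_comp (Equiv.arrowCongr (Equiv.refl (Fin t)) σ)]
  refine Finset.sum_congr rfl fun u _ => ?_
  have : σ.symm ∘ (Equiv.arrowCongr (Equiv.refl (Fin t)) σ) u = u := by ext; simp
  rw [this]

/-- Transport of a measurement along a bijection of orthonormal bases. -/
def POVM.reindex {κ X : Type*} [Fintype κ] [DecidableEq κ] [Fintype X] (E : POVM ι X)
    (e : κ ≃ ι) : POVM κ X where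
  effect x := (E.effect x).submatrix e e
  posSemidef x := (E.posSemidef x).submatrix e
  sum_eq_one := by
    ext i j
    rw [Matrix.sum_apply]
    simp only [submatrix_apply]
    rw [← Matrix.sum_apply, E.sum_eq_one]
    simp [one_apply]

theorem POVM.prob_reindex {κ X : Type*} [Fintype κ] [DecidableEq κ] [Fintype X] (E : POVM ι X)
    (e : κ ≃ ι) (φ : ι → ℂ) (x : X) : (E.reindex e).prob (φ ∘ e) x = E.prob φ x := by
  simp only [POVM.prob, POVM.reindex, submatrix_mulVec_equiv]
  congr 1
  rw [Function.comp_assoc, Equiv.self_comp_symm, Function.comp_id]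
  exact Equiv.sum_comp e fun i => star (φ i) * (E.effect x *ᵥ φ) i

variable {Ω X : Type*} [Fintype Ω] [DecidableEq Ω] [Fintype X]

theorem exists_nonadaptiveAlgorithm_prob_eq {t : ℕ} {ψ : (Fin t → Ω) → ℂ}
    (hψ : star ψ ⬝ᵥ ψ = 1) (E : POVM (Fin t → Ω) X) :
    ∃ A : NonadaptiveAlgorithm Ω X t, ∀ (σ : Equiv.Perm Ω) (x : X),
      A.prob (permRep Ω σ) x = E.prob (fun u => ψ (σ.symm ∘ u)) x := by
  let e : (Fin t → Ω) × Fin 1 ≃ (Fin t → Ω) := Equiv.prodUnique _ _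
  refine ⟨{ N := 1, ψ := ψ ∘ e, norm_ψ := ?_, E := E.reindex e }, fun σ x => ?_⟩
  · rw [← hψ]
    exact Equiv.sum_comp e fun u => star (ψ u) * ψ u
  · rw [NonadaptiveAlgorithm.prob, ← E.prob_reindex e]
    congr 1
    ext ⟨u, m⟩
    rw [NonadaptiveAlgorithm.finalState_permRep]
    rfl

theorem permOp_mulVec_apply (σ : Equiv.Perm ι) (φ : ι → ℂ) (i : ι) :
    (permOp σ *ᵥ φ) i = φ (σ.symm i) := by
  simp [permOp, mulVec, dotProduct, ← Equiv.symm_apply_eq]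

/-- A nonadaptive algorithm is simulated by an adaptive one with the same number of queries: the
`t` registers are cyclically rotated after each query, so that each of them passes once through
the position that is queried. -/
theorem exists_adaptiveAlgorithm_prob_eq {t : ℕ} (ht : t ≠ 0) {ψ : (Fin t → Ω) → ℂ}
    (hψ : star ψ ⬝ᵥ ψ = 1) (E : POVM (Fin t → Ω) X) :
    ∃ A : AdaptiveAlgorithm Ω X t, ∀ (σ : Equiv.Perm Ω) (x : X),
      A.prob (permRep Ω σ) x = E.prob (fun u => ψ (σ.symm ∘ u)) x := by
  obtain ⟨s, rfl⟩ := Nat.exists_eq_succ_of_ne_zero ht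
  let N := Fintype.card (Fin s → Ω)
  let e : Ω × Fin N ≃ (Fin (s + 1) → Ω) :=
    ((Equiv.refl Ω).prodCongr (Fintype.equivFin (Fin s → Ω)).symm).trans
      (Fin.consEquiv fun _ => Ω)
  -- rotation of words: the new letter at `i` is the old one at `i - 1`
  let rot : Equiv.Perm (Fin (s + 1) → Ω) := Equiv.arrowCongr (Equiv.addRight 1) (Equiv.refl Ω)
  let R : Equiv.Perm (Ω × Fin N) := (e.trans rot).trans e.symm
  refine ⟨{ N := N, ψ := ψ ∘ e, norm_ψ := ?_, U := fun _ => permRep _ R⁻¹, E := E.reindex e },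
    fun σ x => ?_⟩
  · rw [← hψ]
    exact Equiv.sum_comp e fun u => star (ψ u) * ψ u
  rw [AdaptiveAlgorithm.prob, ← E.prob_reindex e]
  congr 1
  rw [AdaptiveAlgorithm.finalState]
  simp only [List.ofFn_const, bind_pure_comp, List.map_eq_map, List.foldl_map]
  have hstep : ∀ (χ : (Fin (s + 1) → Ω) → ℂ),
      ((permRep _ R⁻¹ : unitaryGroup (Ω × Fin N) ℂ) : Matrix _ _ ℂ) *ᵥ
        (((permRep Ω σ : Matrix Ω Ω ℂ) ⊗ₖ (1 : Matrix (Fin N) (Fin N) ℂ)) *ᵥ (χ ∘ e)) =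
      (fun w => χ fun i => if i = 0 then σ.symm (rot w i) else rot w i) ∘ e := by
    intro χ
    ext p
    change (permOp R⁻¹ *ᵥ _) p = _
    rw [permOp_mulVec_apply]
    change (((permOp σ) ⊗ₖ (1 : Matrix (Fin N) (Fin N) ℂ)) *ᵥ (χ ∘ e)) (R p) = _
    rw [← Prod.mk.eta (p := R p), kronecker_one_mulVec_apply]
    change (permOp σ *ᵥ fun j => (χ ∘ e) (j, (R p).2)) (R p).1 = _
    rw [permOp_mulVec_apply]
    simp only [Function.comp_apply]
    congr 1
    have hR : rot (e p) = e (R p) := by simp [R]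
    rw [hR]
    ext i
    refine Fin.cases ?_ (fun i => ?_) i <;> simp [e]
  -- After `k` rounds the register that started at position `i` sits at position `i - k`, and it has
  -- been queried if and only if `i < k`.
  have hiter : ∀ k ≤ s + 1, (List.replicate k (permRep (Ω × Fin N) R⁻¹)).foldl
      (fun φ (U : unitaryGroup (Ω × Fin N) ℂ) => (U : Matrix _ _ ℂ) *ᵥ
        (((permRep Ω σ : Matrix Ω Ω ℂ) ⊗ₖ (1 : Matrix (Fin N) (Fin N) ℂ)) *ᵥ φ)) (ψ ∘ e) =
      (fun w => ψ fun i : Fin (s + 1) =>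
        if (i : ℕ) < k then σ.symm (w (i - Fin.ofNat (s + 1) k)) else
          w (i - Fin.ofNat (s + 1) k)) ∘ e := by
    intro k
    induction k with
    | zero => intro _; simp
    | succ k ih =>
      intro hk
      rw [List.replicate_succ', List.foldl_append, ih (by lia), List.foldl_cons, List.foldl_nil,
        hstep]
      congr 1
      ext w
      congr 1
      ext i
      have h0 : i - Fin.ofNat (s + 1) k = 0 ↔ (i : ℕ) = k := by
        rw [sub_eq_zero, Fin.ext_iff, Fin.val_ofNat, Nat.mod_eq_of_lt (by lia)]
      have h1 : rot w (i - Fin.ofNat (s + 1) k) = w (i - Fin.ofNat (s + 1) (k + 1)) := by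
        have h2 : Fin.ofNat (s + 1) (k + 1) = Fin.ofNat (s + 1) k + 1 := by
          ext
          simp [Fin.val_add]
        rw [h2, ← sub_sub]
        simp [rot, sub_eq_add_neg]
      simp only [h0, h1]
      split_ifs <;> first | rfl | lia
  rw [hiter (s + 1) le_rfl]
  congr 1
  ext w
  congr 1
  ext i
  rw [if_pos i.2]
  simp

end Exact

end OracleLearning

theorem theorem6p3 (n : ℕ) (hn : 2 ≤ n) :
    -- exact learning of the sign with `⌊n/2⌋` quantum queries, adaptive or nonadaptive
    (∃ A : AdaptiveAlgorithm (Fin n) ℤˣ (n / 2),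
      ∀ a : Equiv.Perm (Fin n), A.prob (permRep (Fin n) a) (Equiv.Perm.sign a) = 1) ∧
    (∃ A : NonadaptiveAlgorithm (Fin n) ℤˣ (n / 2),
      ∀ a : Equiv.Perm (Fin n), A.prob (permRep (Fin n) a) (Equiv.Perm.sign a) = 1) ∧
    -- with fewer quantum queries the optimal average success probability is `1/2`
    (∀ t < n / 2,
      IsGreatest (Set.range fun A : AdaptiveAlgorithm (Fin n) ℤˣ t =>
        A.successProb (permRep (Fin n)) Equiv.Perm.sign) (1 / 2) ∧
      IsGreatest (Set.range fun A : NonadaptiveAlgorithm (Fin n) ℤˣ t =>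
        A.successProb (permRep (Fin n)) Equiv.Perm.sign) (1 / 2)) ∧
    -- classically, `n - 1` queries suffice, and with fewer queries the optimum is `1/2`
    (∃ T : DecisionTree (Fin n) ℤˣ (n - 1),
      ∀ a : Equiv.Perm (Fin n), T.run a = Equiv.Perm.sign a) ∧
    (∀ t < n - 1,
      IsGreatest (Set.range fun A : ClassicalAlgorithm (Fin n) ℤˣ t =>
        A.successProb (fun a : Equiv.Perm (Fin n) => a) Equiv.Perm.sign) (1 / 2)) := by
  have : Nonempty (Fin n) := ⟨⟨0, by lia⟩⟩
  -- below the threshold every algorithm has success probability exactly `1/2`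
  have key : ∀ {α : Type} {f : α → ℝ}, Nonempty α → (∀ A, f A = 1 / 2) →
      IsGreatest (Set.range f) (1 / 2) := by
    rintro α f ⟨A⟩ h
    refine ⟨⟨A, h A⟩, ?_⟩
    rintro _ ⟨B, rfl⟩
    exact (h B).le
  obtain ⟨ψ, hψ, E, hE⟩ := exists_state_measuring_sign (n := n) (t := n / 2) (by lia) (by lia)
  refine ⟨?_, ?_, fun t ht => ⟨?_, ?_⟩, ?_, fun t ht => ?_⟩
  · obtain ⟨A, hA⟩ := exists_adaptiveAlgorithm_prob_eq (by lia) hψ E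
    exact ⟨A, fun a => (hA a _).trans (hE a)⟩
  · obtain ⟨A, hA⟩ := exists_nonadaptiveAlgorithm_prob_eq hψ E
    exact ⟨A, fun a => (hA a _).trans (hE a)⟩
  · exact key (nonempty_adaptiveAlgorithm t)
      (AdaptiveAlgorithm.successProb_sign_eq_half (by rw [Fintype.card_fin]; lia))
  · exact key (nonempty_nonadaptiveAlgorithm t)
      (NonadaptiveAlgorithm.successProb_sign_eq_half (by rw [Fintype.card_fin]; lia))
  · let q : Fin (n - 1) → Fin n := Fin.castLE (by lia)
    have hq : Function.FactorsThrough (fun a : Equiv.Perm (Fin n) => Equiv.Perm.sign a)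
        fun a : Equiv.Perm (Fin n) => a ∘ q := fun a b hab =>
      congrArg _ (perm_eq_of_comp_eq (Fin.castLE_injective _) (by simp; lia) hab)
    obtain ⟨T, hT⟩ := exists_decisionTree_run_eq q
      (Function.extend (fun a : Equiv.Perm (Fin n) => a ∘ q) (fun a => Equiv.Perm.sign a) 1)
    exact ⟨T, fun a => (hT a).trans (hq.extend_apply 1 a)⟩
  · exact key (nonempty_classicalAlgorithm t)
      (ClassicalAlgorithm.successProb_sign_eq_half (by rw [Fintype.card_fin]; lia))
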